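/- Proposition (Extreme value theorem for Brownian motion). Let $W=(W_t)_{t\ge 0}$ be a standard one-dimensional Brownian motion on a probability space $(\Omega,\mathcal F,\mathbb P)$. For $\varepsilon>0$ let $$A_\varepsilon=\Big\{\max_{0\le t\le 1}W_t\ge \tfrac1\varepsilon\Big\}.$$ Then $\mathbb P(A_\varepsilon)>0$ for every $\varepsilon>0$. Let $\mathbb P^\varepsilon$ be the conditional probability measure $\mathbb P^\varepsilon(E)=\mathbb P(E\cap A_\varepsilon)/\mathbb P(A_\varepsilon)$, $E\in\mathcal F$, and let $\mathbb E_{\mathbb P^\varepsilon}$ be the expectation under $\mathbb P^\varepsilon$. For every $\varepsilon>0$ the random variable $\varepsilon W_1-1$ is $\mathbb P^\varepsilon$-integrable and $$\mathbb E_{\mathbb P^\varepsilon}\big[\,|\varepsilon W_1-1|\,\big]\le \varepsilon\sqrt{\tfrac{2}{\pi}} .$$ In particular, $$\lim_{\varepsilon\downarrow 0}\mathbb E_{\mathbb P^\varepsilon}\big[\,|\varepsilon W_1-1|\,\big]=0 .$$ -/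

import Mathlib

open MeasureTheory ProbabilityTheory Filter Topology
open scoped NNReal

/-- The running maximum of the path `t ↦ W t ω` over the time interval `[0, 1]`. (On a continuous
path the supremum is attained, so it is the maximum.) -/
noncomputable def runningMax {Ω : Type*} (W : ℝ≥0 → Ω → ℝ) (ω : Ω) : ℝ :=
  sSup ((fun t : ℝ≥0 => W t ω) '' Set.Icc 0 1)

/-- The event that the running maximum of `W` over `[0, 1]` is at least `1 / ε`. -/
def highMaxEvent {Ω : Type*} (W : ℝ≥0 → Ω → ℝ) (ε : ℝ) : Set Ω :=
  {ω | 1 / ε ≤ runningMax W ω}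

open scoped ENNReal

/-! Put `a = 1 / ε` and let `τ` be the first time the path reaches `a`. On `τ ≤ 1`, restarting at
`τ` makes `W 1 - a` Gaussian with variance `1 - τ ≤ 1`, so its mean absolute value is at most `√(2 /
π)`; multiplying by `ε` gives the bound. The strong Markov property is avoided by discretising: `τ`
becomes the first grid point with value at least `a - δ`, and only deterministic times are restarted
(`setLIntegral_gridFirstHit_le`). Small grid increments bound the distance from `a` there by `δ`.
Fatou's lemma removes the grid (`setLIntegral_le_runningMax_le_add`), continuity from above removes
`δ` (`setLIntegral_le_runningMax_le`). -/

/-! ### First absolute moment of centred Gaussians. -/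

lemma integral_abs_gaussianReal_zero_one :
    ∫ x, |x| ∂(gaussianReal 0 1) = √(2 / Real.pi) := by
  have hmain : ∫ x in Set.Ioi (0 : ℝ), x * Real.exp (-(2⁻¹ * x ^ 2)) = 1 := by
    have h := integral_rpow_mul_exp_neg_mul_rpow (p := 2) (q := 1) (b := 2⁻¹)
      (by norm_num) (by norm_num) (by norm_num)
    norm_num [Real.rpow_neg_one] at h
    simpa [Real.rpow_neg_one] using h
  rw [integral_gaussianReal_eq_integral_smul one_ne_zero]
  have hpdf : ∀ x : ℝ, gaussianPDFReal 0 1 x • |x|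
      = (√(2 * Real.pi))⁻¹ * (|x| * Real.exp (-(2⁻¹ * |x| ^ 2))) := by
    intro x
    simp only [gaussianPDFReal, smul_eq_mul, sub_zero, NNReal.coe_one, mul_one, sq_abs]
    rw [show -x ^ 2 / 2 = -(2⁻¹ * x ^ 2) by ring]
    ring
  simp_rw [hpdf]
  rw [integral_const_mul, integral_comp_abs (f := fun x => x * Real.exp (-(2⁻¹ * x ^ 2))), hmain]
  rw [Real.sqrt_mul (by norm_num), Real.sqrt_div (by norm_num)]
  have h2 : √2 * √2 = (2 : ℝ) := Real.mul_self_sqrt (by norm_num)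
  have hpi : 0 < √Real.pi := Real.sqrt_pos.2 Real.pi_pos
  have h2pos : 0 < √(2 : ℝ) := by positivity
  field_simp
  linarith

/-- Scaling by `√v ≤ 1` carries the standard Gaussian to variance `v`, which will be the time left
until `1`. -/
lemma lintegral_enorm_gaussianReal_le {v : ℝ≥0} (hv : v ≤ 1) :
    ∫⁻ x, ‖x‖ₑ ∂(gaussianReal 0 v) ≤ ENNReal.ofReal (√(2 / Real.pi)) := by
  have hone : ∫⁻ x, ‖x‖ₑ ∂(gaussianReal 0 1) = ENNReal.ofReal (√(2 / Real.pi)) := by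
    rw [← integral_abs_gaussianReal_zero_one, ← ofReal_integral_norm_eq_lintegral_enorm]
    · rfl
    · exact IsGaussian.integrable_id
  have hmap : gaussianReal 0 v = (gaussianReal 0 1).map (√v * ·) := by
    rw [gaussianReal_map_const_mul]
    congr 1
    · simp
    · ext; simp
  rw [hmap, lintegral_map (by fun_prop) (by fun_prop), ← hone]
  refine lintegral_mono fun x => ?_
  rw [enorm_mul]
  refine mul_le_of_le_one_left' ?_
  rw [Real.enorm_eq_ofReal (Real.sqrt_nonneg _), ENNReal.ofReal_le_one, Real.sqrt_le_one]
  exact_mod_cast hv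

/-! ### Pathwise facts about grids and the running maximum. -/

/-- The `k`-th point of the uniform grid of mesh `1 / (n + 1)`. -/
noncomputable def gridTime (n k : ℕ) : ℝ≥0 := k / (n + 1)

lemma gridTime_zero (n : ℕ) : gridTime n 0 = 0 := by simp [gridTime]

lemma gridTime_le_one {n k : ℕ} (hk : k ≤ n + 1) : gridTime n k ≤ 1 := by
  unfold gridTime
  rw [div_le_one (by positivity)]
  exact_mod_cast hk

lemma gridTime_mono (n : ℕ) : Monotone (gridTime n) := by
  intro j k hjk
  unfold gridTime
  gcongr

section Grid

variable {Ω : Type*}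

/-- The process reaches the level `b` on the grid for the first time at the `k`-th point. -/
def gridFirstHit (W : ℝ≥0 → Ω → ℝ) (b : ℝ) (n k : ℕ) : Set Ω :=
  {ω | b ≤ W (gridTime n k) ω ∧ ∀ j < k, W (gridTime n j) ω < b}

/-- The process reaches the level `b` at some grid point of `[0, 1]`. -/
def gridHit (W : ℝ≥0 → Ω → ℝ) (b : ℝ) (n : ℕ) : Set Ω :=
  {ω | ∃ k ≤ n + 1, b ≤ W (gridTime n k) ω}

/-- All increments over one grid step in `[0, 1]` are at most `δ` in absolute value. -/
def gridSmallIncr (W : ℝ≥0 → Ω → ℝ) (δ : ℝ) (n : ℕ) : Set Ω :=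
  {ω | ∀ k ≤ n, |W (gridTime n (k + 1)) ω - W (gridTime n k) ω| ≤ δ}

lemma gridHit_eq_biUnion_gridFirstHit (W : ℝ≥0 → Ω → ℝ) (b : ℝ) (n : ℕ) :
    gridHit W b n = ⋃ k ∈ Finset.range (n + 2), gridFirstHit W b n k := by
  classical
  ext ω
  simp only [gridHit, gridFirstHit, Set.mem_ofPred_eq, Set.mem_iUnion, Finset.mem_range,
    exists_prop]
  constructor
  · rintro ⟨k, hk, hb⟩
    have hex : ∃ k, b ≤ W (gridTime n k) ω := ⟨k, hb⟩
    exact ⟨Nat.find hex, by have := Nat.find_min' hex hb; omega, Nat.find_spec hex,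
      fun j hj => not_le.1 (Nat.find_min hex hj)⟩
  · rintro ⟨k, hk, hb, -⟩
    exact ⟨k, by omega, hb⟩

lemma pairwise_disjoint_gridFirstHit (W : ℝ≥0 → Ω → ℝ) (b : ℝ) (n : ℕ) :
    Pairwise (Function.onFun Disjoint (gridFirstHit W b n)) := by
  intro i j hij
  rw [Function.onFun, Set.disjoint_left]
  rintro ω ⟨hi, hi'⟩ ⟨hj, hj'⟩
  rcases lt_or_gt_of_ne hij with h | h
  · exact (hj' i h).not_ge hi
  · exact (hi' j h).not_ge hj

lemma bddAbove_image_of_continuous {W : ℝ≥0 → Ω → ℝ} {ω : Ω} (hω : Continuous (W · ω)) :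
    BddAbove ((fun t : ℝ≥0 => W t ω) '' Set.Icc 0 1) :=
  (isCompact_Icc.image hω).bddAbove

lemma le_runningMax {W : ℝ≥0 → Ω → ℝ} {ω : Ω} (hω : Continuous (W · ω)) {t : ℝ≥0}
    (ht : t ≤ 1) : W t ω ≤ runningMax W ω :=
  le_csSup (bddAbove_image_of_continuous hω) ⟨t, ⟨zero_le, ht⟩, rfl⟩

lemma exists_eq_runningMax {W : ℝ≥0 → Ω → ℝ} {ω : Ω} (hω : Continuous (W · ω)) :
    ∃ t ≤ (1 : ℝ≥0), W t ω = runningMax W ω := by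
  have hne : ((fun t : ℝ≥0 => W t ω) '' Set.Icc 0 1).Nonempty := ⟨_, 0, by simp, rfl⟩
  obtain ⟨t, ht, h⟩ := (isCompact_Icc.image hω).sSup_mem hne
  exact ⟨t, ht.2, h⟩

lemma le_runningMax_of_mem_gridHit {W : ℝ≥0 → Ω → ℝ} {ω : Ω} (hω : Continuous (W · ω)) {b : ℝ}
    {n : ℕ} (h : ω ∈ gridHit W b n) : b ≤ runningMax W ω := by
  obtain ⟨k, hk, hb⟩ := h
  exact hb.trans (le_runningMax hω (gridTime_le_one hk))

/-- Uniform continuity on `[0, 1]`. The grid may miss the maximiser, hence the lowered level `a -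
δ`. -/
lemma eventually_mem_gridHit_inter_gridSmallIncr {W : ℝ≥0 → Ω → ℝ} {ω : Ω}
    (hω : Continuous (W · ω)) {a δ : ℝ} (hδ : 0 < δ) (ha : a ≤ runningMax W ω) :
    ∀ᶠ n : ℕ in atTop, ω ∈ gridHit W (a - δ) n ∩ gridSmallIncr W δ n := by
  have huc : UniformContinuousOn (W · ω) (Set.Icc (0 : ℝ≥0) 1) :=
    isCompact_Icc.uniformContinuousOn_of_continuous hω.continuousOn
  obtain ⟨η, hη, h⟩ := Metric.uniformContinuousOn_iff.1 huc δ hδ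
  obtain ⟨N, hN⟩ := exists_nat_one_div_lt hη
  obtain ⟨t, ht, htmax⟩ := exists_eq_runningMax hω
  filter_upwards [eventually_ge_atTop N] with n hn
  have hmesh : 1 / ((n : ℝ) + 1) < η :=
    lt_of_le_of_lt (one_div_le_one_div_of_le (by positivity) (by gcongr)) hN
  have hpos : (0 : ℝ) < n + 1 := by positivity
  constructor
  -- Last grid point at or before the maximiser `t`.
  · obtain ⟨k, hk⟩ : ∃ k, k = ⌊t * ((n : ℝ≥0) + 1)⌋₊ := ⟨_, rfl⟩
    have hk1 : (k : ℝ) ≤ t * (n + 1) := by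
      have := Nat.floor_le (show 0 ≤ t * ((n : ℝ≥0) + 1) from zero_le)
      rw [← hk] at this
      exact_mod_cast this
    have hk2 : (t : ℝ) * (n + 1) < k + 1 := by
      have := Nat.lt_floor_add_one (t * ((n : ℝ≥0) + 1))
      rw [← hk] at this
      exact_mod_cast this
    have ht' : (t : ℝ) ≤ 1 := by exact_mod_cast ht
    have hkn : k ≤ n + 1 := by
      have : (k : ℝ) ≤ n + 1 := hk1.trans (by nlinarith)
      exact_mod_cast this
    refine ⟨k, hkn, ?_⟩
    have hdist : dist (gridTime n k) t < η := by
      refine lt_of_le_of_lt ?_ hmesh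
      rw [NNReal.dist_eq]
      simp only [gridTime, NNReal.coe_div, NNReal.coe_natCast, NNReal.coe_add, NNReal.coe_one]
      rw [div_sub' hpos.ne', abs_div, abs_of_pos hpos, div_le_div_iff_of_pos_right hpos, abs_le]
      constructor <;> linarith
    have := h _ ⟨zero_le, gridTime_le_one hkn⟩ _ ⟨zero_le, ht⟩ hdist
    rw [Real.dist_eq, abs_lt] at this
    linarith [this.1]
  · intro k hk
    have hdist : dist (gridTime n (k + 1)) (gridTime n k) < η := by
      convert hmesh using 1
      rw [NNReal.dist_eq]
      simp only [gridTime, NNReal.coe_div, NNReal.coe_natCast, NNReal.coe_add, NNReal.coe_one]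
      rw [← sub_div, Nat.cast_add, Nat.cast_one, add_sub_cancel_left, abs_of_pos (by positivity)]
    have := h _ ⟨zero_le, gridTime_le_one (by omega)⟩ _ ⟨zero_le, gridTime_le_one (by omega)⟩ hdist
    exact this.le

/-- On a path starting below the level `a - δ` and with grid increments at most `δ`, the overshoot
at the first grid hitting point is at most `δ`. -/
lemma abs_sub_le_of_mem_gridFirstHit {W : ℝ≥0 → Ω → ℝ} {ω : Ω} {a δ : ℝ} (hδ : 0 < δ)
    {n k : ℕ} (hk : k ≤ n + 1) (h0 : W 0 ω < a - δ) (hE : ω ∈ gridFirstHit W (a - δ) n k)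
    (hG : ω ∈ gridSmallIncr W δ n) (x : ℝ) :
    |x - a| ≤ |x - W (gridTime n k) ω| + δ := by
  obtain ⟨h1, h2⟩ := hE
  have hclose : |W (gridTime n k) ω - a| ≤ δ := by
    cases k with
    | zero => rw [gridTime_zero] at h1; linarith
    | succ k =>
      have h3 := h2 k (Nat.lt_succ_self k)
      have h4 := (abs_le.1 (hG k (by omega))).2
      rw [abs_le]
      constructor <;> linarith
  exact (abs_sub_le x (W (gridTime n k) ω) a).trans (by linarith)

end Grid

/-! ### Measurability and the restart at grid times. -/

section Brownian

variable {Ω : Type*} [MeasurableSpace Ω] {P : Measure Ω} {W : ℝ≥0 → Ω → ℝ}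

lemma nullMeasurableSet_gridFirstHit (hm : ∀ t, AEMeasurable (W t) P) (b : ℝ) (n k : ℕ) :
    NullMeasurableSet (gridFirstHit W b n k) P := by
  have : gridFirstHit W b n k = {ω | b ≤ W (gridTime n k) ω} ∩
      ⋂ j ∈ Finset.range k, {ω | W (gridTime n j) ω < b} := by
    ext ω; simp [gridFirstHit]
  rw [this]
  exact (nullMeasurableSet_le aemeasurable_const (hm _)).inter
    (Finset.nullMeasurableSet_biInter _ fun j _ => nullMeasurableSet_lt (hm _) aemeasurable_const)

lemma nullMeasurableSet_gridHit (hm : ∀ t, AEMeasurable (W t) P) (b : ℝ) (n : ℕ) :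
    NullMeasurableSet (gridHit W b n) P := by
  rw [gridHit_eq_biUnion_gridFirstHit]
  exact Finset.nullMeasurableSet_biUnion _ fun k _ => nullMeasurableSet_gridFirstHit hm b n k

lemma nullMeasurableSet_gridSmallIncr (hm : ∀ t, AEMeasurable (W t) P) (δ : ℝ) (n : ℕ) :
    NullMeasurableSet (gridSmallIncr W δ n) P := by
  have : gridSmallIncr W δ n = ⋂ k ∈ Finset.range (n + 1),
      {ω | |W (gridTime n (k + 1)) ω - W (gridTime n k) ω| ≤ δ} := by
    ext ω; simp [gridSmallIncr]
  rw [this]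
  refine Finset.nullMeasurableSet_biInter _ fun k _ => ?_
  exact nullMeasurableSet_le (continuous_abs.measurable.comp_aemeasurable ((hm _).sub (hm _)))
    aemeasurable_const

/-- The supremum is over uncountably many times; on continuous paths countably many grid events
determine it. -/
lemma nullMeasurableSet_le_runningMax (hm : ∀ t, AEMeasurable (W t) P)
    (hc : ∀ᵐ ω ∂P, Continuous (W · ω)) (a : ℝ) :
    NullMeasurableSet {ω | a ≤ runningMax W ω} P := by
  have hS : NullMeasurableSet (⋂ m : ℕ, ⋃ n : ℕ, gridHit W (a - 1 / ((m : ℝ) + 1)) n) P :=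
    .iInter fun m => .iUnion fun n => nullMeasurableSet_gridHit hm _ _
  refine hS.congr ?_
  filter_upwards [hc] with ω hω
  refine propext ⟨fun h => ?_, fun h => ?_⟩
  · have h' : ∀ m : ℕ, a - 1 / ((m : ℝ) + 1) ≤ runningMax W ω := fun m => by
      obtain ⟨n, hn⟩ := Set.mem_iUnion.1 (Set.mem_iInter.1 h m)
      exact le_runningMax_of_mem_gridHit hω hn
    have hlim : Tendsto (fun m : ℕ => a - 1 / ((m : ℝ) + 1)) atTop (𝓝 (a - 0)) :=
      tendsto_const_nhds.sub tendsto_one_div_add_atTop_nhds_zero_nat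
    rw [sub_zero] at hlim
    exact le_of_tendsto' hlim h'
  · refine Set.mem_iInter.2 fun m => Set.mem_iUnion.2 ?_
    obtain ⟨n, hn⟩ := (eventually_mem_gridHit_inter_gridSmallIncr hω
      (show (0 : ℝ) < 1 / ((m : ℝ) + 1) by positivity) h).exists
    exact ⟨n, hn.1⟩

/-- A first hit at `t` depends only on the path up to `t`, so it is independent of `W 1 - W t`. -/
lemma setLIntegral_gridFirstHit_le (hW : IsBrownianReal W P) (b : ℝ)
    {n k : ℕ} (hk : k ≤ n + 1) :
    ∫⁻ ω in gridFirstHit W b n k, ‖W 1 ω - W (gridTime n k) ω‖ₑ ∂P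
      ≤ ENNReal.ofReal (√(2 / Real.pi)) * P (gridFirstHit W b n k) := by
  set t := gridTime n k with ht
  have hm := hW.aemeasurable
  have ht1 : t ≤ 1 := gridTime_le_one hk
  -- The first-hit event as a measurable set of paths on `[0, t]`, the form the independence of the
  -- shifted process needs.
  let S : Set (Set.Iic t → ℝ) := {x | b ≤ x ⟨t, Set.mem_Iic.2 le_rfl⟩} ∩
    ⋂ j : Fin k, {x | x ⟨gridTime n j, Set.mem_Iic.2 (gridTime_mono n j.2.le)⟩ < b}
  have hS : MeasurableSet S :=
    (measurableSet_le measurable_const (measurable_pi_apply _)).inter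
      (.iInter fun j => measurableSet_lt (measurable_pi_apply _) measurable_const)
  have hpre : (fun ω (s : Set.Iic t) => W s ω) ⁻¹' S = gridFirstHit W b n k := by
    ext ω
    simp only [S, gridFirstHit, Set.mem_preimage, Set.mem_inter_iff, Set.mem_ofPred_eq,
      Set.mem_iInter, ht]
    exact and_congr_right fun _ => ⟨fun h j hj => h ⟨j, hj⟩, fun h j => h j j.2⟩
  have hindep := (hW.indepFun_shift t).comp
    (φ := fun x : ℝ≥0 → ℝ => ‖x (1 - t)‖ₑ) (ψ := S.indicator (1 : (Set.Iic t → ℝ) → ℝ≥0∞))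
    (by fun_prop) (measurable_one.indicator hS)
  have hE := nullMeasurableSet_gridFirstHit hm b n k
  have hfun : (S.indicator (1 : (Set.Iic t → ℝ) → ℝ≥0∞)) ∘ (fun ω (s : Set.Iic t) => W s ω)
      = (gridFirstHit W b n k).indicator 1 := by
    rw [← hpre]; rfl
  have hfun' : (fun x : ℝ≥0 → ℝ => ‖x (1 - t)‖ₑ) ∘ (fun ω s => W (t + s) ω - W t ω)
      = fun ω => ‖W 1 ω - W t ω‖ₑ := by
    ext ω; simp [add_tsub_cancel_of_le ht1]
  rw [hfun, hfun'] at hindep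
  have hlaw : HasLaw (fun ω => W 1 ω - W t ω) (gaussianReal 0 (1 - t)) P := by
    have := (hW.shift t).hasLaw_eval (1 - t)
    simpa [add_tsub_cancel_of_le ht1] using this
  have hnorm : ∫⁻ ω, ‖W 1 ω - W t ω‖ₑ ∂P ≤ ENNReal.ofReal (√(2 / Real.pi)) := by
    have := hlaw.lintegral_comp (f := fun x => ‖x‖ₑ) (by fun_prop)
    rw [this]
    exact lintegral_enorm_gaussianReal_le tsub_le_self
  calc ∫⁻ ω in gridFirstHit W b n k, ‖W 1 ω - W t ω‖ₑ ∂P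
      = ∫⁻ ω, ‖W 1 ω - W t ω‖ₑ * (gridFirstHit W b n k).indicator 1 ω ∂P := by
        rw [← lintegral_indicator₀ hE]
        refine lintegral_congr fun ω => ?_
        by_cases h : ω ∈ gridFirstHit W b n k <;> simp [h]
    _ = (∫⁻ ω, ‖W 1 ω - W t ω‖ₑ ∂P) * ∫⁻ ω, (gridFirstHit W b n k).indicator 1 ω ∂P :=
        lintegral_mul_eq_lintegral_mul_lintegral_of_indepFun''
          ((hm 1).sub (hm t)).enorm (aemeasurable_one.indicator₀ hE) hindep
    _ ≤ _ := by
        rw [lintegral_indicator_one₀ hE]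
        gcongr

lemma setLIntegral_gridHit_inter_gridSmallIncr_le (hW : IsBrownianReal W P) {a δ : ℝ} (hδ : 0 < δ)
    (hδa : δ < a) (n : ℕ) :
    ∫⁻ ω in gridHit W (a - δ) n ∩ gridSmallIncr W δ n, ‖W 1 ω - a‖ₑ ∂P
      ≤ ENNReal.ofReal (√(2 / Real.pi) + δ) * P {ω | a - δ ≤ runningMax W ω} := by
  have hm := hW.aemeasurable
  have hG := nullMeasurableSet_gridSmallIncr hm δ n
  have hE := nullMeasurableSet_gridFirstHit hm (a - δ) n
  have hdisj := pairwise_disjoint_gridFirstHit W (a - δ) n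
  have hk : ∀ k ∈ Finset.range (n + 2),
      ∫⁻ ω in gridFirstHit W (a - δ) n k ∩ gridSmallIncr W δ n, ‖W 1 ω - a‖ₑ ∂P
        ≤ ENNReal.ofReal (√(2 / Real.pi) + δ) * P (gridFirstHit W (a - δ) n k) := by
    intro k hk
    have hk' : k ≤ n + 1 := by have := Finset.mem_range.1 hk; omega
    calc ∫⁻ ω in gridFirstHit W (a - δ) n k ∩ gridSmallIncr W δ n, ‖W 1 ω - a‖ₑ ∂P
        ≤ ∫⁻ ω in gridFirstHit W (a - δ) n k ∩ gridSmallIncr W δ n,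
            (‖W 1 ω - W (gridTime n k) ω‖ₑ + ENNReal.ofReal δ) ∂P := by
          refine lintegral_mono_ae ?_
          filter_upwards [ae_restrict_mem₀ ((hE k).inter hG),
            ae_restrict_of_ae hW.eval_zero_ae_eq_zero] with ω hω h0
          rw [Real.enorm_eq_ofReal_abs, Real.enorm_eq_ofReal_abs,
            ← ENNReal.ofReal_add (abs_nonneg _) hδ.le]
          exact ENNReal.ofReal_le_ofReal (abs_sub_le_of_mem_gridFirstHit hδ hk'
            (by rw [h0]; linarith) hω.1 hω.2 _)
      -- The small-increment event also looks past the hitting time, so it must be dropped before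
      -- independence is used.
      _ ≤ ∫⁻ ω in gridFirstHit W (a - δ) n k,
            (‖W 1 ω - W (gridTime n k) ω‖ₑ + ENNReal.ofReal δ) ∂P :=
          lintegral_mono_set Set.inter_subset_left
      _ ≤ _ := by
          rw [lintegral_add_right _ measurable_const, setLIntegral_const,
            ENNReal.ofReal_add (Real.sqrt_nonneg _) hδ.le, add_mul]
          gcongr
          exact setLIntegral_gridFirstHit_le hW _ hk'
  calc ∫⁻ ω in gridHit W (a - δ) n ∩ gridSmallIncr W δ n, ‖W 1 ω - a‖ₑ ∂P
      = ∑ k ∈ Finset.range (n + 2),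
          ∫⁻ ω in gridFirstHit W (a - δ) n k ∩ gridSmallIncr W δ n, ‖W 1 ω - a‖ₑ ∂P := by
        rw [gridHit_eq_biUnion_gridFirstHit, Set.iUnion₂_inter, lintegral_biUnion_finset₀]
        · exact fun i _ j _ hij =>
            ((hdisj hij).mono Set.inter_subset_left Set.inter_subset_left).aedisjoint
        · exact fun k _ => (hE k).inter hG
    _ ≤ ∑ k ∈ Finset.range (n + 2),
          ENNReal.ofReal (√(2 / Real.pi) + δ) * P (gridFirstHit W (a - δ) n k) :=
        Finset.sum_le_sum hk
    _ = ENNReal.ofReal (√(2 / Real.pi) + δ) * P (gridHit W (a - δ) n) := by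
        rw [← Finset.mul_sum, gridHit_eq_biUnion_gridFirstHit, measure_biUnion_finset₀]
        · exact fun i _ j _ hij => (hdisj hij).aedisjoint
        · exact fun k _ => hE k
    _ ≤ _ := by
        refine mul_le_mul_right (measure_mono_ae ?_) _
        filter_upwards [hW.cont] with ω hω h using le_runningMax_of_mem_gridHit hω h

/-! ### Limits in the mesh and in `δ`. -/

/-- Almost every path in the event lies in all fine enough grid events, whose integrals are bounded
uniformly in `n`; Fatou's lemma concludes. -/
lemma setLIntegral_le_runningMax_le_add (hW : IsBrownianReal W P) {a δ : ℝ} (hδ : 0 < δ)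
    (hδa : δ < a) :
    ∫⁻ ω in {ω | a ≤ runningMax W ω}, ‖W 1 ω - a‖ₑ ∂P
      ≤ ENNReal.ofReal (√(2 / Real.pi) + δ) * P {ω | a - δ ≤ runningMax W ω} := by
  have hm := hW.aemeasurable
  have hD : ∀ n, NullMeasurableSet (gridHit W (a - δ) n ∩ gridSmallIncr W δ n) P := fun n =>
    (nullMeasurableSet_gridHit hm _ n).inter (nullMeasurableSet_gridSmallIncr hm _ n)
  have hA := nullMeasurableSet_le_runningMax hm hW.cont a
  have hf : AEMeasurable (fun ω => ‖W 1 ω - a‖ₑ) P := ((hm 1).sub_const a).enorm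
  calc ∫⁻ ω in {ω | a ≤ runningMax W ω}, ‖W 1 ω - a‖ₑ ∂P
      = ∫⁻ ω, {ω | a ≤ runningMax W ω}.indicator (fun ω => ‖W 1 ω - a‖ₑ) ω ∂P :=
        (lintegral_indicator₀ hA _).symm
    _ ≤ ∫⁻ ω, liminf (fun n => (gridHit W (a - δ) n ∩ gridSmallIncr W δ n).indicator
          (fun ω => ‖W 1 ω - a‖ₑ) ω) atTop ∂P := by
        refine lintegral_mono_ae ?_
        filter_upwards [hW.cont] with ω hω
        refine Set.indicator_apply_le' (fun h => ?_) (fun _ => zero_le)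
        refine le_liminf_of_le (by isBoundedDefault) ?_
        filter_upwards [eventually_mem_gridHit_inter_gridSmallIncr hω hδ h] with n hn
        rw [Set.indicator_of_mem hn]
    _ ≤ liminf (fun n => ∫⁻ ω, (gridHit W (a - δ) n ∩ gridSmallIncr W δ n).indicator
          (fun ω => ‖W 1 ω - a‖ₑ) ω ∂P) atTop :=
        lintegral_liminf_le' fun n => hf.indicator₀ (hD n)
    _ ≤ _ := by
        refine liminf_le_of_frequently_le' (Frequently.of_forall fun n => ?_)
        rw [lintegral_indicator₀ (hD n)]
        exact setLIntegral_gridHit_inter_gridSmallIncr_le hW hδ hδa n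

lemma setLIntegral_le_runningMax_le (hW : IsBrownianReal W P) {a : ℝ} (ha : 0 < a) :
    ∫⁻ ω in {ω | a ≤ runningMax W ω}, ‖W 1 ω - a‖ₑ ∂P
      ≤ ENNReal.ofReal (√(2 / Real.pi)) * P {ω | a ≤ runningMax W ω} := by
  have : IsProbabilityMeasure P := hW.isGaussianProcess.isProbabilityMeasure
  have hm := hW.aemeasurable
  -- The second `+ 1` keeps `δ m < a` already at `m = 0`.
  let δ : ℕ → ℝ := fun m => a * (1 / ((m : ℝ) + 1 + 1))
  have hδpos : ∀ m, 0 < δ m := fun m => by positivity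
  have hδlt : ∀ m, δ m < a := fun m => by
    refine mul_lt_of_lt_one_right ha ?_
    rw [div_lt_one (by positivity)]
    have : (0 : ℝ) ≤ m := Nat.cast_nonneg m
    linarith
  have hδanti : Antitone δ := fun i j hij => by
    refine mul_le_mul_of_nonneg_left (one_div_le_one_div_of_le (by positivity) ?_) ha.le
    gcongr
  have hδlim : Tendsto δ atTop (𝓝 0) := by
    have := (tendsto_one_div_add_atTop_nhds_zero_nat (𝕜 := ℝ)).comp (tendsto_add_atTop_nat 1)
    simpa [δ, Function.comp_def] using this.const_mul a
  have hInter : ⋂ m, {ω | a - δ m ≤ runningMax W ω} = {ω | a ≤ runningMax W ω} := by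
    ext ω
    simp only [Set.mem_iInter, Set.mem_ofPred_eq]
    refine ⟨fun h => ?_, fun h m => by linarith [hδpos m]⟩
    have hlim : Tendsto (fun m => a - δ m) atTop (𝓝 (a - 0)) := tendsto_const_nhds.sub hδlim
    rw [sub_zero] at hlim
    exact le_of_tendsto' hlim h
  have hmeas : Tendsto (fun m => P {ω | a - δ m ≤ runningMax W ω}) atTop
      (𝓝 (P {ω | a ≤ runningMax W ω})) := by
    rw [← hInter]
    refine tendsto_measure_iInter_atTop
      (fun m => nullMeasurableSet_le_runningMax hm hW.cont _) ?_ ⟨0, measure_ne_top _ _⟩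
    intro i j hij ω hω
    have := hδanti hij
    simp only [Set.mem_ofPred_eq] at hω ⊢
    linarith
  have hconst : Tendsto (fun m => ENNReal.ofReal (√(2 / Real.pi) + δ m)) atTop
      (𝓝 (ENNReal.ofReal (√(2 / Real.pi)))) := by
    have := ENNReal.tendsto_ofReal (hδlim.const_add (√(2 / Real.pi)))
    rwa [add_zero] at this
  refine ge_of_tendsto' (ENNReal.Tendsto.mul hconst (Or.inr (measure_ne_top _ _)) hmeas
    (Or.inr ENNReal.ofReal_ne_top)) fun m => ?_
  exact setLIntegral_le_runningMax_le_add hW (hδpos m) (hδlt m)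

/-- The maximum dominates `W 1`, whose Gaussian law charges every half-line. -/
lemma measure_le_runningMax_pos (hW : IsBrownianReal W P) (a : ℝ) :
    0 < P {ω | a ≤ runningMax W ω} := by
  have hlaw := hW.hasLaw_eval 1
  have hpos : 0 < P (W 1 ⁻¹' Set.Ici a) := by
    rw [← Measure.map_apply_of_aemeasurable hlaw.aemeasurable measurableSet_Ici, hlaw.map_eq,
      pos_iff_ne_zero]
    intro h
    -- A Gaussian-null half-line would be Lebesgue-null.
    have := gaussianReal_absolutelyContinuous' 0 one_ne_zero h
    simp at this
  refine hpos.trans_le (measure_mono_ae ?_)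
  filter_upwards [hW.cont] with ω hω h using le_trans h (le_runningMax hω le_rfl)

lemma lintegral_cond_highMaxEvent_le (hW : IsBrownianReal W P) {ε : ℝ} (hε : 0 < ε) :
    ∫⁻ ω, ENNReal.ofReal |ε * W 1 ω - 1| ∂(cond P (highMaxEvent W ε))
      ≤ ENNReal.ofReal (ε * √(2 / Real.pi)) := by
  have : IsProbabilityMeasure P := hW.isGaussianProcess.isProbabilityMeasure
  have hpos : 0 < P (highMaxEvent W ε) := measure_le_runningMax_pos hW _
  have hint : ∫⁻ ω in highMaxEvent W ε, ‖W 1 ω - 1 / ε‖ₑ ∂P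
      ≤ ENNReal.ofReal (√(2 / Real.pi)) * P (highMaxEvent W ε) :=
    setLIntegral_le_runningMax_le hW (by positivity)
  have hscale : ∀ ω, ENNReal.ofReal |ε * W 1 ω - 1|
      = ENNReal.ofReal ε * ‖W 1 ω - 1 / ε‖ₑ := fun ω => by
    rw [Real.enorm_eq_ofReal_abs, ← ENNReal.ofReal_mul hε.le]
    congr 1
    rw [← abs_of_pos hε, ← abs_mul, abs_of_pos hε]
    congr 1
    field_simp
  simp_rw [hscale]
  rw [lintegral_const_mul' _ _ ENNReal.ofReal_ne_top, ENNReal.ofReal_mul hε.le]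
  gcongr
  rw [ProbabilityTheory.cond, lintegral_smul_measure, smul_eq_mul]
  calc (P (highMaxEvent W ε))⁻¹ * ∫⁻ ω in highMaxEvent W ε, ‖W 1 ω - 1 / ε‖ₑ ∂P
      ≤ (P (highMaxEvent W ε))⁻¹ * (ENNReal.ofReal (√(2 / Real.pi)) * P (highMaxEvent W ε)) := by
        gcongr
    _ = ENNReal.ofReal (√(2 / Real.pi)) := by
        rw [mul_comm, mul_assoc, ENNReal.mul_inv_cancel hpos.ne' (measure_ne_top _ _), mul_one]

end Brownian

theorem mainTheorem4 {Ω : Type*} [MeasurableSpace Ω] (P : Measure Ω) [IsProbabilityMeasure P]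
    (W : ℝ≥0 → Ω → ℝ) (hW : IsBrownianReal W P) :
    (∀ ε : ℝ, 0 < ε →
      NullMeasurableSet (highMaxEvent W ε) P ∧
      0 < P (highMaxEvent W ε) ∧
      Integrable (fun ω => |ε * W 1 ω - 1|) (cond P (highMaxEvent W ε)) ∧
      ∫ ω, |ε * W 1 ω - 1| ∂(cond P (highMaxEvent W ε)) ≤ ε * √(2 / Real.pi)) ∧
    Tendsto (fun ε : ℝ => ∫ ω, |ε * W 1 ω - 1| ∂(cond P (highMaxEvent W ε)))
      (𝓝[>] 0) (𝓝 0) := by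
  have hbound : ∀ ε : ℝ, 0 < ε →
      Integrable (fun ω => |ε * W 1 ω - 1|) (cond P (highMaxEvent W ε)) ∧
      ∫ ω, |ε * W 1 ω - 1| ∂(cond P (highMaxEvent W ε)) ≤ ε * √(2 / Real.pi) := by
    intro ε hε
    have hle := lintegral_cond_highMaxEvent_le hW hε
    have hmeas : AEStronglyMeasurable (fun ω => |ε * W 1 ω - 1|) (cond P (highMaxEvent W ε)) := by
      have h : AEMeasurable (fun ω => |ε * W 1 ω - 1|) P :=
        continuous_abs.measurable.comp_aemeasurable
          (((hW.aemeasurable 1).const_mul ε).sub_const 1)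
      exact (h.mono_ac cond_absolutelyContinuous).aestronglyMeasurable
    have hnonneg : 0 ≤ᵐ[cond P (highMaxEvent W ε)] fun ω => |ε * W 1 ω - 1| :=
      ae_of_all _ fun _ => abs_nonneg _
    refine ⟨⟨hmeas, ?_⟩, ?_⟩
    · rw [hasFiniteIntegral_iff_ofReal hnonneg]
      exact hle.trans_lt ENNReal.ofReal_lt_top
    · rw [integral_eq_lintegral_of_nonneg_ae hnonneg hmeas]
      exact ENNReal.toReal_le_of_le_ofReal (by positivity) hle
  refine ⟨fun ε hε => ⟨nullMeasurableSet_le_runningMax hW.aemeasurable hW.cont _,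
    measure_le_runningMax_pos hW _, hbound ε hε⟩, ?_⟩
  have hlim : Tendsto (fun ε : ℝ => ε * √(2 / Real.pi)) (𝓝[>] 0) (𝓝 0) := by
    have h : Tendsto (fun ε : ℝ => ε * √(2 / Real.pi)) (𝓝 0) (𝓝 (0 * √(2 / Real.pi))) :=
      tendsto_id.mul_const _
    rw [zero_mul] at h
    exact h.mono_left nhdsWithin_le_nhds
  refine tendsto_of_tendsto_of_tendsto_of_le_of_le' tendsto_const_nhds hlim
    (Eventually.of_forall fun ε => integral_nonneg fun _ => abs_nonneg _) ?_
  filter_upwards [self_mem_nhdsWithin] with ε hε using (hbound ε hε).2
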